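/- Consider the following two machine models over a finite input alphabet $\Sigma$. A one-tape off-line Turing machine has a finite control and one semi-infinite tape, which initially contains the input starting from the leftmost square and blanks elsewhere; in each move it writes a nonblank symbol on the scanned square and moves its head left, right or not at all, and it stops in accepting and in rejecting states. For a computation $\mathcal C$ of such a machine, the crossing sequence at a boundary between two adjacent squares is the sequence of the states in which the head successively crosses this boundary, and $c(\mathcal C)$ is the length of the longest crossing sequence. A standard Turing machine has a finite control, a two-way read-only input tape (the input is delimited by endmarkers) and a separate semi-infinite worktape; it is one-way if its input head never moves to the left. The space $s(\mathcal C)$ of a computation is the number of worktape squares scanned in it. For a resource $r\in\{c,s\}$ and a machine accepting the language $L$, let $r(x)$ be, under the strong measure, the maximum of $r(\mathcal C)$ over all computations on the input $x$; under the accept measure, the maximum, and under the weak measure, the minimum of $r(\mathcal C)$ over the accepting computations on $x$ if $x\in L$, and $0$ if $x\notin L$. In each case put $r(n)=\max\{r(x) : x\in\Sigma^*,\ |x|=n\}$. These quantities may be $\infty$. As usual, a machine works in space $f(n)$ if it uses at most $\max\{1,f(n)\}$ worktape squares (every machine scans at least one square). Theorem. For every (deterministic or nondeterministic) one-tape off-line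 Turing machine $M$ there is a one-way nondeterministic standard Turing machine $M'$ that accepts the same language and such that, for every function $c:\mathbb N\to\mathbb N\cup\{\infty\}$: (1) if $M$ uses crossing sequences of length at most $c(n)$ under the weak measure, then $M'$ works in space $c(n)$ under the weak measure; (2) if $M$ uses crossing sequences of length at most $c(n)$ under the strong measure or under the accept measure, then $M'$ works in space $c(n)$ under the accept measure. -/

import Mathlib

/-- A head move on a semi-infinite tape. -/
inductive HeadMove where
  | left
  | stay
  | right

/-- The square reached by a move from a given square of a tape with squares `0, 1, 2, …`.
A left move from the leftmost square is not possible. -/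
def HeadMove.apply : HeadMove → ℕ → Option ℕ
  | .left, 0 => none
  | .left, p + 1 => some p
  | .stay, p => some p
  | .right, p => some (p + 1)

/-- A (maximal) computation of a transition system, started in the configuration `init`.
It visits the configurations `cfg 0, …, cfg len` if `len` is finite (and then no step is possible
from `cfg len`), and all the `cfg i` if `len = ⊤`. Values of `cfg` beyond `len` are irrelevant. -/
structure MachineComputation {Cfg : Type*} (Step : Cfg → Cfg → Prop) (init : Cfg) where
  cfg : ℕ → Cfg
  len : ℕ∞
  cfg_zero : cfg 0 = init
  step : ∀ i : ℕ, (i : ℕ∞) < len → Step (cfg i) (cfg (i + 1))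
  maximal : ∀ n : ℕ, len = n → ∀ d, ¬ Step (cfg n) d

/-! ### Resources of nondeterministic machines

`Comp x` is the type of computations on the input `x`, `acc` singles out the accepting ones, and
`r C` is the amount of a resource used by the computation `C`. -/

section Resources

variable {A : Type*} {Comp : List A → Type*}

/-- The set of strings with an accepting computation. -/
def acceptedLanguage (acc : ∀ x, Comp x → Prop) : Language A :=
  {x | ∃ C : Comp x, acc x C}

/-- Strong measure on an input: maximum over all computations. -/
noncomputable def strongOn (r : ∀ x, Comp x → ℕ∞) (x : List A) : ℕ∞ :=
  ⨆ C : Comp x, r x C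

open Classical in
/-- Accept measure on an input: maximum over the accepting computations, `0` if there are none. -/
noncomputable def acceptOn (acc : ∀ x, Comp x → Prop) (r : ∀ x, Comp x → ℕ∞) (x : List A) : ℕ∞ :=
  if x ∈ acceptedLanguage acc then ⨆ C : {C : Comp x // acc x C}, r x C.1 else 0

open Classical in
/-- Weak measure on an input: minimum over the accepting computations, `0` if there are none. -/
noncomputable def weakOn (acc : ∀ x, Comp x → Prop) (r : ∀ x, Comp x → ℕ∞) (x : List A) : ℕ∞ :=
  if x ∈ acceptedLanguage acc then ⨅ C : {C : Comp x // acc x C}, r x C.1 else 0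

/-- The worst case among all inputs of length `n`. -/
noncomputable def worstCase (f : List A → ℕ∞) (n : ℕ) : ℕ∞ :=
  ⨆ x : {x : List A // x.length = n}, f x.1

end Resources

/-! ### One-tape off-line machines -/

/-- A (nondeterministic) one-tape off-line Turing machine with input alphabet `A`.
`Sym` is the set of nonblank tape symbols; the content of a square is an `Option Sym`, where `none`
is the blank, which is never written. A deterministic machine is one in which all the sets
`trans q s` have at most one element. -/
structure OneTapeTM (A : Type*) where
  State : Type
  Sym : Type
  finite_state : Finite State
  finite_sym : Finite Sym
  input : A ↪ Sym
  start : State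
  accept : Set State
  reject : Set State
  disjoint : Disjoint accept reject
  trans : State → Option Sym → Set (State × Sym × HeadMove)

namespace OneTapeTM

variable {A : Type*} (M : OneTapeTM A)

/-- A configuration: state, content of the semi-infinite tape, scanned square. -/
structure Cfg where
  state : M.State
  tape : ℕ → Option M.Sym
  head : ℕ

/-- The input is written from the leftmost square on, all other squares are blank. -/
def init (x : List A) : M.Cfg where
  state := M.start
  tape := fun p => x[p]?.map M.input
  head := 0

/-- One move. The machine stops in accepting and rejecting states. -/
def Step (c d : M.Cfg) : Prop :=
  c.state ∉ M.accept ∧ c.state ∉ M.reject ∧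
    ∃ (s : M.Sym) (m : HeadMove), (d.state, s, m) ∈ M.trans c.state (c.tape c.head) ∧
      d.tape = Function.update c.tape c.head (some s) ∧
      m.apply c.head = some d.head

/-- The computations on the input `x`. -/
abbrev Comp (x : List A) : Type := MachineComputation M.Step (M.init x)

/-- A computation is accepting if it stops in an accepting state. -/
def Accepting (x : List A) (C : M.Comp x) : Prop :=
  ∃ n : ℕ, C.len = n ∧ (C.cfg n).state ∈ M.accept

/-- The accepted language. -/
def language : Language A := acceptedLanguage M.Accepting

variable {M} in
/-- The moves of `C` that cross the boundary `b`, which is the one between the squares `b` and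
`b + 1`: move `i` leads from `C.cfg i` to `C.cfg (i + 1)`. The crossing sequence of `C` at `b`
consists of the states `(C.cfg (i + 1)).state`, where `i` runs through this set increasingly. -/
def crossings {x : List A} (C : M.Comp x) (b : ℕ) : Set ℕ :=
  {i | (i : ℕ∞) < C.len ∧
    ((C.cfg i).head = b ∧ (C.cfg (i + 1)).head = b + 1 ∨
      (C.cfg i).head = b + 1 ∧ (C.cfg (i + 1)).head = b)}

/-- The number of states in the longest crossing sequence of a computation. -/
noncomputable def crossingLength (x : List A) (C : M.Comp x) : ℕ∞ :=
  ⨆ b : ℕ, (crossings C b).encard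

/-- Length `c(n)` of the crossing sequences under the strong measure. -/
noncomputable def strongCrossing : ℕ → ℕ∞ := worstCase (strongOn M.crossingLength)

/-- Length `c(n)` of the crossing sequences under the accept measure. -/
noncomputable def acceptCrossing : ℕ → ℕ∞ := worstCase (acceptOn M.Accepting M.crossingLength)

/-- Length `c(n)` of the crossing sequences under the weak measure. -/
noncomputable def weakCrossing : ℕ → ℕ∞ := worstCase (weakOn M.Accepting M.crossingLength)

end OneTapeTM

/-! ### Standard machines -/

/-- What the input head can read: an input symbol or one of the two endmarkers. -/
inductive InputSym (A : Type*) where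
  | leftEnd
  | sym (a : A)
  | rightEnd

/-- The input tape: the left endmarker on square `0`, the input `x` on the squares
`1, …, x.length`, the right endmarker on square `x.length + 1`. -/
def inputAt {A : Type*} (x : List A) : ℕ → InputSym A
  | 0 => .leftEnd
  | p + 1 => (x[p]?.map InputSym.sym).getD .rightEnd

/-- A (nondeterministic) standard Turing machine with input alphabet `A`: a two-way read-only input
tape and a separate semi-infinite worktape with alphabet `Work`. In `(q, w, m, m') ∈ trans p a v`,
`q` is the new state, `w` the symbol written on the worktape, `m` the move of the input head and
`m'` the move of the worktape head. -/
structure StandardTM (A : Type*) where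
  State : Type
  Work : Type
  finite_state : Finite State
  finite_work : Finite Work
  blank : Work
  start : State
  accept : Set State
  reject : Set State
  disjoint : Disjoint accept reject
  trans : State → InputSym A → Work → Set (State × Work × HeadMove × HeadMove)

namespace StandardTM

variable {A : Type*} (M : StandardTM A)

/-- A configuration: state, position of the input head, content of the worktape, position of the
worktape head. -/
structure Cfg where
  state : M.State
  inputHead : ℕ
  tape : ℕ → M.Work
  head : ℕ

/-- Both heads start on the leftmost square of their tape; the worktape is blank. -/
def init : M.Cfg where
  state := M.start
  inputHead := 0
  tape := fun _ => M.blank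
  head := 0

/-- One move on the input `x`. The machine stops in accepting and rejecting states, and the input
head cannot leave the part of the input tape delimited by the endmarkers. -/
def Step (x : List A) (c d : M.Cfg) : Prop :=
  c.state ∉ M.accept ∧ c.state ∉ M.reject ∧
    ∃ (w : M.Work) (m m' : HeadMove),
      (d.state, w, m, m') ∈ M.trans c.state (inputAt x c.inputHead) (c.tape c.head) ∧
      d.tape = Function.update c.tape c.head w ∧
      m.apply c.inputHead = some d.inputHead ∧ d.inputHead ≤ x.length + 1 ∧
      m'.apply c.head = some d.head

/-- The computations on the input `x`. -/
abbrev Comp (x : List A) : Type := MachineComputation (M.Step x) M.init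

/-- A computation is accepting if it stops in an accepting state. -/
def Accepting (x : List A) (C : M.Comp x) : Prop :=
  ∃ n : ℕ, C.len = n ∧ (C.cfg n).state ∈ M.accept

/-- The accepted language. -/
def language : Language A := acceptedLanguage M.Accepting

/-- The machine is one-way if its input head never moves to the left. -/
def OneWay : Prop :=
  ∀ (p : M.State) (a : InputSym A) (v : M.Work), ∀ t ∈ M.trans p a v, t.2.2.1 ≠ HeadMove.left

/-- The space used by a computation: the number of worktape squares scanned in it (including the
square scanned at the beginning). -/
noncomputable def space (x : List A) (C : M.Comp x) : ℕ∞ :=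
  {p : ℕ | ∃ i : ℕ, (i : ℕ∞) ≤ C.len ∧ (C.cfg i).head = p}.encard

/-- Space `s(n)` under the accept measure. -/
noncomputable def acceptSpace : ℕ → ℕ∞ := worstCase (acceptOn M.Accepting M.space)

/-- Space `s(n)` under the weak measure. -/
noncomputable def weakSpace : ℕ → ℕ∞ := worstCase (weakOn M.Accepting M.space)

end StandardTM

/-! The simulating machine treats the squares of `M` one after the other, from left to right. For
square `b` it replays the whole history of that square from time `0`. It reads off the crossing
sequence on the left, which was guessed during the preceding square, and guesses the one on the
right. The content of the square fits into the finite control, so only two crossing sequences need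
the worktape, on two tracks. Each square is treated once, so its initial content is read once and
the input head never turns back; beyond the input it waits on the right endmarker. The simulation
succeeds at a square whose right crossing sequence is empty.

Two comparisons of lengths are needed. Fed with the true crossing sequences of an accepting
computation, the simulation succeeds and needs no more space than the longest of them, or one square
(`exists_simReach`, `SimReach.simulatorReach`, `exists_simulator_comp`); this gives the weak bound.
Conversely, sequences that fit together at every square can be glued to an accepting computation of
`M` with crossing sequences at least as long as the longest guessed one, unless that one has length
at most `1` (`SimReach.invariant`, `SimulatorInv.step`, `exists_comp_of_simulator`); this gives the
accept bound. Nothing bounds the space of unsuccessful guesses, so even a strong bound for `M`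
yields only an accept bound.

The gluing rests on `LeftRun`: the squares `< b` can act according to a given crossing sequence,
whatever happens further right. Replaying square `b` extends such a run to the squares `≤ b`. The
counts `n j` record how often each boundary is crossed. -/

/-! ### Crossing sequences and left parts of computations -/

/-- Whether a move from square `p` to square `p'` crosses the boundary `j`, as a number. -/
def crossCount (p p' j : ℕ) : ℕ :=
  if p = j ∧ p' = j + 1 ∨ p = j + 1 ∧ p' = j then 1 else 0

/-- The part of the machine that is known while a single square is simulated: the head is on the
square in a given state, or somewhere to the left, or somewhere to the right. -/
inductive SquareStatus (Q : Type) where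
  | inside (q : Q)
  | onLeft
  | onRight

/-- The operations on the two crossing sequences of a square: checking the next state of the left
one, and appending a state to the right one. -/
inductive QueueOp (Q : Type) where
  | idle
  | push (q : Q)
  | pop (q : Q)

namespace OneTapeTM

variable {A : Type*} (M : OneTapeTM A)

/-- `M.LeftRun b c L n`: from `c` on, the squares `< b` can be operated until acceptance or until
the head leaves for good, the boundary to the left of square `b` being crossed in the states `L`.
The state in which the head returns from the right is arbitrary. The boundary `j` is crossed
`n j` times. -/
inductive LeftRun (b : ℕ) : M.Cfg → List M.State → (ℕ → ℕ) → Prop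
  | out {c} : c.head = b → LeftRun b c [] 0
  | accept {c} : c.head < b → c.state ∈ M.accept → LeftRun b c [] 0
  | step {c d L n} : c.head < b → M.Step c d → d.head < b → LeftRun b d L n →
      LeftRun b c L (crossCount c.head d.head + n)
  | exit {c d L n} : c.head < b → M.Step c d → d.head = b → LeftRun b d L n →
      LeftRun b c (d.state :: L) (crossCount c.head d.head + n)
  | ret {c L n} (q : M.State) (k : ℕ) : c.head = b → b = k + 1 → LeftRun b ⟨q, c.tape, k⟩ L n →
      LeftRun b c (q :: L) (crossCount b k + n)

variable {M}

/-- A left part does not depend on the tape to the right of it, nor on the state while the head is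
outside. -/
theorem LeftRun.congr {b : ℕ} {c : M.Cfg} {L : List M.State} {n : ℕ → ℕ} (h : M.LeftRun b c L n) :
    ∀ d : M.Cfg, d.head = c.head → (c.head < b → d.state = c.state) →
      (∀ p < b, d.tape p = c.tape p) → M.LeftRun b d L n := by
  induction h with
  | out h => exact fun d hd _ _ => .out (hd.trans h)
  | accept h ha => exact fun d hd hs _ => .accept (hd ▸ h) (hs h ▸ ha)
  | @step c e L n hc hstep he _ ih =>
    intro d hd hs ht
    obtain ⟨h1, h2, s, m, h3, h4, h5⟩ := hstep
    rw [← hd]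
    refine .step (d := ⟨e.state, Function.update d.tape d.head (some s), e.head⟩) (hd ▸ hc)
      ⟨hs hc ▸ h1, hs hc ▸ h2, s, m, ?_, rfl, hd ▸ h5⟩ he (ih _ rfl (fun _ => rfl) ?_)
    · rw [hs hc, hd, ht _ hc]; exact h3
    · intro p hp
      simp only [h4, hd, Function.update_apply, ht p hp]
  | @exit c e L n hc hstep he _ ih =>
    intro d hd hs ht
    obtain ⟨h1, h2, s, m, h3, h4, h5⟩ := hstep
    rw [← hd]
    refine .exit (d := ⟨e.state, Function.update d.tape d.head (some s), e.head⟩) (hd ▸ hc)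
      ⟨hs hc ▸ h1, hs hc ▸ h2, s, m, ?_, rfl, hd ▸ h5⟩ he (ih _ rfl (fun _ => rfl) ?_)
    · rw [hs hc, hd, ht _ hc]; exact h3
    · intro p hp
      simp only [h4, hd, Function.update_apply, ht p hp]
  | ret q k hc hb _ ih =>
    intro d hd hs ht
    exact .ret q k (hd.trans hc) hb (ih _ rfl (fun _ => rfl) ht)

theorem LeftRun.eq_zero_of_head_eq {b : ℕ} {c : M.Cfg} {n : ℕ → ℕ} (h : M.LeftRun b c [] n)
    (hc : c.head = b) : n = 0 := by
  cases h with
  | out => rfl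
  | accept => rfl
  | step h1 => omega

/-- With the head outside, only `ret` can consume a state. Its condition `b = k + 1` also excludes a
left move from square `0`. -/
theorem LeftRun.pop_of_head_eq {b : ℕ} {c : M.Cfg} {q : M.State} {L : List M.State} {n : ℕ → ℕ}
    (h : M.LeftRun b c (q :: L) n) (hc : c.head = b) :
    ∃ k n', b = k + 1 ∧ n = crossCount b k + n' ∧ M.LeftRun b ⟨q, c.tape, k⟩ L n' := by
  cases h with
  | step h1 => omega
  | exit h1 => omega
  | ret _ k _ hb h => exact ⟨k, _, hb, rfl, h⟩

/-- A left part that is inside proceeds to the next crossing of its boundary, and so does the left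
part that has one more square. -/
theorem LeftRun.pop_of_head_lt {b : ℕ} {c : M.Cfg} {L' : List M.State} {n : ℕ → ℕ}
    (h : M.LeftRun b c L' n) : ∀ {q L}, L' = q :: L → c.head < b →
    ∃ d n₁ n₂, n = n₁ + n₂ ∧ d.head = b ∧ d.state = q ∧ (∀ p, b ≤ p → d.tape p = c.tape p) ∧
      M.LeftRun b d L n₂ ∧
      ∀ R n', M.LeftRun (b + 1) d R n' → M.LeftRun (b + 1) c R (n₁ + n') := by
  induction h with
  | out => intro q L h; cases h
  | accept => intro q L h; cases h
  | @step c e L n hc hstep he _ ih =>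
    intro q L hL _
    obtain ⟨d, n₁, n₂, rfl, h1, h2, h3, h4, h5⟩ := ih hL he
    refine ⟨d, crossCount c.head e.head + n₁, n₂, by rw [add_assoc], h1, h2, ?_, h4, ?_⟩
    · intro p hp
      obtain ⟨-, -, s, m, -, ht, -⟩ := hstep
      rw [h3 p hp, ht, Function.update_of_ne (by omega)]
    · intro R n' h
      rw [add_assoc]
      exact .step (by omega) hstep (by omega) (h5 R n' h)
  | @exit c e L n hc hstep he h _ =>
    intro q L' hL _
    obtain ⟨rfl, rfl⟩ := List.cons.inj hL
    refine ⟨e, crossCount c.head e.head, n, rfl, he, rfl, ?_, h, ?_⟩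
    · intro p hp
      obtain ⟨-, -, s, m, -, ht, -⟩ := hstep
      rw [ht, Function.update_of_ne (by omega)]
    · intro R n' h
      -- For the squares `≤ b` the move onto square `b` is internal and contributes no state.
      exact .step (by omega) hstep (by omega) h
  | ret q k hc => intro _ _ _ _; omega

/-- The run accepts without ever reaching square `b`, so the same moves serve for one more square.
-/
theorem LeftRun.succ_of_head_lt {b : ℕ} {c : M.Cfg} {L : List M.State} {n : ℕ → ℕ}
    (h : M.LeftRun b c L n) : L = [] → c.head < b → M.LeftRun (b + 1) c [] n := by
  induction h with
  | out => intros; omega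
  | accept h ha => exact fun _ _ => .accept (by omega) ha
  | step h hs hd _ ih => exact fun hL _ => .step (by omega) hs (by omega) (ih hL hd)
  | exit => intro h; cases h
  | ret => intro h; cases h

/-- A left part that is never left is an accepting computation. -/
theorem LeftRun.exists_path {b : ℕ} {c : M.Cfg} {L : List M.State} {n : ℕ → ℕ}
    (h : M.LeftRun b c L n) : L = [] → c.head < b →
    ∃ (l : ℕ) (f : ℕ → M.Cfg), f 0 = c ∧ (∀ i < l, M.Step (f i) (f (i + 1))) ∧
      (f l).state ∈ M.accept ∧
      ∀ j, n j = ∑ i ∈ Finset.range l, crossCount (f i).head (f (i + 1)).head j := by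
  induction h with
  | out => intros; omega
  | @accept c h ha => exact fun _ _ => ⟨0, fun _ => c, rfl, by simp, ha, by simp⟩
  | @step c d L n h hs hd _ ih =>
    intro hL _
    obtain ⟨l, f, rfl, h1, h2, h3⟩ := ih hL hd
    refine ⟨l + 1, fun i => Nat.casesOn i c f, rfl, ?_, h2, fun j => ?_⟩
    · rintro (_ | i) hi
      · exact hs
      · exact h1 i (by omega)
    · rw [Finset.sum_range_succ', Pi.add_apply, h3, add_comm]; rfl
  | exit => intro h; cases h
  | ret => intro h; cases h

theorem sum_crossCount_eq (f : ℕ → ℕ) (l j : ℕ) :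
    ((∑ i ∈ Finset.range l, crossCount (f i) (f (i + 1)) j : ℕ) : ℕ∞) =
      {i : ℕ | i < l ∧ (f i = j ∧ f (i + 1) = j + 1 ∨ f i = j + 1 ∧ f (i + 1) = j)}.encard := by
  unfold crossCount
  rw [← Finset.card_filter, ← Set.encard_coe_eq_coe_finsetCard]
  simp

theorem LeftRun.exists_comp {b : ℕ} {x : List A} {n : ℕ → ℕ}
    (h : M.LeftRun (b + 1) (M.init x) [] n) :
    ∃ C : M.Comp x, M.Accepting x C ∧ ∀ j, (n j : ℕ∞) ≤ M.crossingLength x C := by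
  obtain ⟨l, f, h0, h1, h2, h3⟩ := h.exists_path rfl (Nat.succ_pos b)
  refine ⟨⟨f, l, h0, fun i hi => h1 i (by exact_mod_cast hi), ?_⟩, ⟨l, rfl, h2⟩, fun j => ?_⟩
  · intro m hm d hd
    rw [Nat.cast_inj] at hm
    exact hd.1 (hm ▸ h2)
  · rw [h3, sum_crossCount_eq (fun i => (f i).head)]
    refine le_trans (le_of_eq ?_) (le_iSup _ j)
    simp [crossings]

variable (M)

/-! ### The square by square simulation as an abstract transition system -/

/-- The moves of the simulation of a single square: content and status before the move, operation
on the crossing sequences, content and status after the move. -/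
inductive SquareMove :
    Option M.Sym → SquareStatus M.State → QueueOp M.State → Option M.Sym →
      SquareStatus M.State → Prop
  | stay {q s q' s'} : q ∉ M.accept → q ∉ M.reject → (q', s', .stay) ∈ M.trans q s →
      SquareMove s (.inside q) .idle (some s') (.inside q')
  | right {q s q' s'} : q ∉ M.accept → q ∉ M.reject → (q', s', .right) ∈ M.trans q s →
      SquareMove s (.inside q) (.push q') (some s') .onRight
  | left {q s q' s'} : q ∉ M.accept → q ∉ M.reject → (q', s', .left) ∈ M.trans q s →
      SquareMove s (.inside q) (.pop q') (some s') .onLeft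
  | ret {s} (q) : SquareMove s .onRight (.push q) s (.inside q)
  | enter {s} (q) : SquareMove s .onLeft (.pop q) s (.inside q)

/-- The statuses in which the simulation of a square may end. -/
def FinalStatus : SquareStatus M.State → Prop
  | .inside q => q ∈ M.accept
  | .onLeft => True
  | .onRight => True

/-- A configuration of the square by square simulation: the current square, its content, its
status, the rest of the crossing sequence on the left of it, the crossing sequence on the right of
it so far, and whether the latter is nonempty and complete. -/
structure SimCfg where
  pos : ℕ
  sym : Option M.Sym
  status : SquareStatus M.State
  left : List M.State
  right : List M.State
  closed : Bool

/-- The steps of the square by square simulation on the input `x`. -/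
inductive SimStep (x : List A) : M.SimCfg → M.SimCfg → Prop
  | idle {b s t s' t' L R e} : M.SquareMove s t .idle s' t' →
      SimStep x ⟨b, s, t, L, R, e⟩ ⟨b, s', t', L, R, e⟩
  -- `e` is a guess whether `q` is the last state of the right sequence; once it is `true`, no
  -- further push is possible.
  | push {b s t s' t' L R q} (e) : M.SquareMove s t (.push q) s' t' →
      SimStep x ⟨b, s, t, L, R, false⟩ ⟨b, s', t', L, R ++ [q], e⟩
  | pop {b s t s' t' L R q e} : M.SquareMove s t (.pop q) s' t' →
      SimStep x ⟨b, s, t, q :: L, R, e⟩ ⟨b, s', t', L, R, e⟩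
  | next {b s t R} : M.FinalStatus t → R ≠ [] →
      SimStep x ⟨b, s, t, [], R, true⟩ ⟨b + 1, (M.init x).tape (b + 1), .onLeft, R, [], false⟩

/-- The simulation on `x` reaches a configuration, and the maximum of `1` and the lengths of the
crossing sequences is `m` so far. -/
inductive SimReach (x : List A) : M.SimCfg → ℕ → Prop
  | init : SimReach x ⟨0, (M.init x).tape 0, .inside M.start, [], [], false⟩ 1
  | step {a a' m} : SimReach x a m → M.SimStep x a a' → SimReach x a' (max m a'.right.length)

/-- The simulation ends successfully. -/
def SimCfg.Accepting {M : OneTapeTM A} (a : M.SimCfg) : Prop :=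
  a.left = [] ∧ a.right = [] ∧ M.FinalStatus a.status

variable {M}

theorem SimReach.one_le {x : List A} {a : M.SimCfg} {m : ℕ} (h : M.SimReach x a m) : 1 ≤ m := by
  induction h with
  | init => rfl
  | step _ _ ih => exact le_max_of_le_left ih

theorem SimReach.right_le {x : List A} {a : M.SimCfg} {m : ℕ} (h : M.SimReach x a m) :
    a.right.length ≤ m := by
  cases h with
  | init => simp
  | step => exact le_max_right _ _

/-! ### Successful simulations come from accepting computations -/

/-- The position of the head agrees with the status of square `b`. -/
def StatusAt (b : ℕ) (c : M.Cfg) : SquareStatus M.State → Prop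
  | .inside q => c.head = b ∧ c.state = q
  | .onLeft => c.head < b
  | .onRight => c.head = b + 1

/-- The invariant of the simulation: there is a run of the squares `≤ a.pos` that has led to a
configuration `c`, and the squares `< a.pos` can proceed as predicted. -/
def SimInvariant (x : List A) (a : M.SimCfg) (m : ℕ) : Prop :=
  ∃ (c : M.Cfg) (n₁ n₂ : ℕ → ℕ), StatusAt a.pos c a.status ∧ c.tape a.pos = a.sym ∧
    -- In status `onRight` the head is on `a.pos + 1`; for the squares `< a.pos` it is merely
    -- outside, which `LeftRun` expresses by the position `a.pos`.
    M.LeftRun a.pos ⟨c.state, c.tape, min c.head a.pos⟩ a.left n₂ ∧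
    -- The past in continuation form: every run from `c` extends backwards to the initial
    -- configuration. `n₁` counts the past crossings, `n₂` those still predicted for the left part.
    (∀ R n, M.LeftRun (a.pos + 1) c R n →
      M.LeftRun (a.pos + 1) (M.init x) (a.right ++ R) (n₁ + n)) ∧
    (m ≤ 1 ∨ ∃ j, m ≤ n₁ j + n₂ j) ∧ a.right.length ≤ n₁ a.pos

theorem crossCount_succ (b : ℕ) : crossCount b (b + 1) b = 1 := by simp [crossCount]

theorem crossCount_succ' (b : ℕ) : crossCount (b + 1) b b = 1 := by simp [crossCount]

/-- When a square is finished, its past and the rest of the left part combine to a run of all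
squares up to it. This serves both for passing to the next square and for final acceptance. -/
theorem SimInvariant.leftRun_init {x : List A} {a : M.SimCfg} {m : ℕ} (h : SimInvariant x a m)
    (hL : a.left = []) (ht : M.FinalStatus a.status) :
    ∃ n, M.LeftRun (a.pos + 1) (M.init x) a.right n ∧ (m ≤ 1 ∨ ∃ j, m ≤ n j) := by
  obtain ⟨c, n₁, n₂, h1, -, h3, h4, h5, -⟩ := h
  obtain ⟨b, s, t, L, R, e⟩ := a
  subst hL
  dsimp only at *
  suffices M.LeftRun (b + 1) c [] n₂ from
    ⟨n₁ + n₂, by simpa using h4 [] n₂ this, h5⟩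
  cases t with
  | inside q =>
    obtain rfl := h3.eq_zero_of_head_eq (by simp [h1.1])
    exact .accept (by rw [h1.1]; omega) (by rw [h1.2]; exact ht)
  | onLeft =>
    have h1 : c.head < b := h1
    refine LeftRun.succ_of_head_lt (b := b) ?_ rfl h1
    rwa [min_eq_left h1.le] at h3
  | onRight =>
    have h1 : c.head = b + 1 := h1
    obtain rfl := h3.eq_zero_of_head_eq (by simp [h1])
    exact .out h1

theorem max_le_count {m r : ℕ} (b : ℕ) {n n' : ℕ → ℕ} (h : m ≤ 1 ∨ ∃ j, m ≤ n j)
    (hn : ∀ j, n j ≤ n' j) (hr : r ≤ n' b) : max m r ≤ 1 ∨ ∃ j, max m r ≤ n' j := by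
  rcases le_total m r with hmr | hmr
  · exact .inr ⟨b, by rwa [max_eq_right hmr]⟩
  · rw [max_eq_left hmr]
    exact h.imp_right fun ⟨j, hj⟩ => ⟨j, hj.trans (hn j)⟩

/-- A push adds a crossing of the boundary `a.pos` to `n₁`, which accounts for the longer right
sequence. A pop shifts crossings from `n₂` to `n₁` and preserves the sum. -/
theorem SimInvariant.step {x : List A} {a a' : M.SimCfg} {m : ℕ} (h : SimInvariant x a m)
    (hs : M.SimStep x a a') : SimInvariant x a' (max m a'.right.length) := by
  cases hs with
  | @next b s t R ht hR =>
    obtain ⟨n, h1, h2⟩ := h.leftRun_init rfl ht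
    -- The next square is replayed from time `0`: nothing is past, and the run just completed is the
    -- predicted left part.
    refine ⟨M.init x, 0, n, Nat.succ_pos b, rfl, ?_, by simp, ?_, by simp⟩
    · simpa [init] using h1
    · simpa using h2
  | @idle b s t s' t' L R e hmove =>
    obtain ⟨c, n₁, n₂, h1, h2, h3, h4, h5, h6⟩ := h
    dsimp only at *
    cases hmove with
    | @stay q s q' s' ha hr hmem =>
      obtain ⟨hb, rfl⟩ := h1
      have hstep : M.Step c ⟨q', Function.update c.tape c.head (some s'), c.head⟩ :=
        ⟨ha, hr, s', .stay, by rw [hb, h2]; exact hmem, rfl, rfl⟩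
      refine ⟨⟨q', Function.update c.tape c.head (some s'), c.head⟩, n₁ + crossCount c.head c.head,
        n₂, ⟨hb, rfl⟩, by simp [← hb], ?_, ?_, max_le_count b h5 (by intro j; simp) (by simp; omega),
        h6.trans (by simp)⟩
      · refine h3.congr _ rfl (by simp [hb]) fun p hp => ?_
        simp [Function.update_of_ne (show p ≠ c.head by omega)]
      · intro R' n hn
        have := LeftRun.step (by dsimp only; omega) hstep (by dsimp only; omega) hn
        rw [add_assoc]
        exact h4 _ _ this
  | @push b s t s' t' L R q e hmove =>
    obtain ⟨c, n₁, n₂, h1, h2, h3, h4, h5, h6⟩ := h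
    dsimp only at *
    cases hmove with
    | @right q s q' s' ha hr hmem =>
      obtain ⟨hb, rfl⟩ := h1
      have hstep : M.Step c ⟨q, Function.update c.tape c.head (some s'), b + 1⟩ :=
        ⟨ha, hr, s', .right, by rw [hb, h2]; exact hmem, rfl, by rw [hb]; rfl⟩
      refine ⟨⟨q, Function.update c.tape c.head (some s'), b + 1⟩, n₁ + crossCount c.head (b + 1),
        n₂, rfl, by simp [← hb], ?_, ?_, max_le_count b h5 (by intro j; simp) ?_, ?_⟩
      · refine h3.congr _ (by simp [hb]) (by simp [hb]) fun p hp => ?_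
        simp [Function.update_of_ne (show p ≠ c.head by omega)]
      · intro R' n hn
        rw [add_assoc, List.append_assoc]
        exact h4 _ _ (.exit (by omega) hstep rfl hn)
      · simp [hb, crossCount_succ]; omega
      · simp [hb, crossCount_succ]; omega
    | ret =>
      have hb : c.head = b + 1 := h1
      refine ⟨⟨q, c.tape, b⟩, n₁ + crossCount (b + 1) b, n₂, ⟨rfl, rfl⟩, h2, ?_, ?_,
        max_le_count b h5 (by intro j; simp) ?_, ?_⟩
      · exact h3.congr _ (by simp [hb]) (by simp [hb]) fun p hp => rfl
      · intro R' n hn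
        rw [add_assoc, List.append_assoc]
        exact h4 _ _ (.ret q b hb rfl hn)
      · simp [crossCount_succ']; omega
      · simp [crossCount_succ']; omega
  | @pop b s t s' t' L R q e hmove =>
    obtain ⟨c, n₁, n₂, h1, h2, h3, h4, h5, h6⟩ := h
    dsimp only at *
    cases hmove with
    | @left q s q' s' ha hr hmem =>
      obtain ⟨hb, rfl⟩ := h1
      obtain ⟨k, n', rfl, rfl, h3'⟩ := h3.pop_of_head_eq (by simp [hb])
      have hstep : M.Step c ⟨q, Function.update c.tape c.head (some s'), k⟩ :=
        ⟨ha, hr, s', .left, by rw [hb, h2]; exact hmem, rfl, by rw [hb]; rfl⟩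
      refine ⟨⟨q, Function.update c.tape c.head (some s'), k⟩, n₁ + crossCount (k + 1) k, n',
        Nat.lt_succ_self k, by simp [← hb], ?_, ?_,
        max_le_count (k + 1) h5 (by intro j; simp; omega) (by simp; omega),
        h6.trans (by simp)⟩
      · refine h3'.congr _ (by simp) (by simp) fun p hp => ?_
        simp [Function.update_of_ne (show p ≠ c.head by omega)]
      · intro R' n hn
        have := LeftRun.step (by dsimp only; omega) hstep (by dsimp only; omega) hn
        rw [hb] at this
        rw [add_assoc n₁]
        exact h4 _ _ this
    | enter =>
      have hb : c.head < b := h1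
      rw [min_eq_left hb.le] at h3
      -- The left squares work on their own until the head returns; the popped state is the one of
      -- this return.
      obtain ⟨d, m₁, m₂, rfl, hd, rfl, ht, h3, h7⟩ := h3.pop_of_head_lt rfl hb
      refine ⟨d, n₁ + m₁, m₂, ⟨hd, rfl⟩, by rw [ht b le_rfl]; exact h2, ?_, ?_,
        max_le_count b h5 (by intro j; simp; omega) (by simp; omega), h6.trans (by simp)⟩
      · exact h3.congr _ (by simp [hd]) (by simp) fun p hp => rfl
      · intro R' n hn
        rw [add_assoc]
        exact h4 _ _ (h7 _ _ hn)

theorem SimReach.invariant {x : List A} {a : M.SimCfg} {m : ℕ} (h : M.SimReach x a m) :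
    SimInvariant x a m := by
  induction h with
  | init =>
    exact ⟨M.init x, 0, 0, ⟨rfl, rfl⟩, rfl, .out (by simp), by simp, .inl le_rfl, by simp⟩
  | step _ hs ih => exact ih.step hs

/-- A successful simulation yields an accepting computation with crossing sequences that are at
least as long. -/
theorem SimReach.exists_comp {x : List A} {a : M.SimCfg} {m : ℕ} (h : M.SimReach x a m)
    (ha : a.Accepting) :
    ∃ C : M.Comp x, M.Accepting x C ∧ (m : ℕ∞) ≤ max 1 (M.crossingLength x C) := by
  obtain ⟨n, h1, h2⟩ := h.invariant.leftRun_init ha.1 ha.2.2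
  rw [ha.2.1] at h1
  obtain ⟨C, hC, hn⟩ := h1.exists_comp
  refine ⟨C, hC, ?_⟩
  rcases h2 with h2 | ⟨j, h2⟩
  · exact le_max_of_le_left (by exact_mod_cast h2)
  · exact le_max_of_le_right ((Nat.cast_le.2 h2).trans (hn j))

/-! ### The simulation follows a given computation -/

/-- The state in which move `i` of the path `f` crosses the boundary `b`, if it does. -/
def crossingState (f : ℕ → M.Cfg) (b i : ℕ) : List M.State :=
  if (f i).head = b ∧ (f (i + 1)).head = b + 1 ∨ (f i).head = b + 1 ∧ (f (i + 1)).head = b then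
    [(f (i + 1)).state] else []

/-- The crossing sequence at the boundary `b` before time `i`. -/
def pastCrossings (f : ℕ → M.Cfg) (b i : ℕ) : List M.State :=
  (List.range i).flatMap (crossingState f b)

/-- The crossing sequence at the boundary `b` from time `i` on, until time `l`. -/
def futureCrossings (f : ℕ → M.Cfg) (l b i : ℕ) : List M.State :=
  (List.range' i (l - i)).flatMap (crossingState f b)

/-- The crossing sequence on the left of square `b` from time `i` on, until time `l`. -/
def futureLeft (f : ℕ → M.Cfg) (l : ℕ) : ℕ → ℕ → List M.State
  | 0, _ => []
  | b + 1, i => futureCrossings f l b i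

theorem pastCrossings_succ (f : ℕ → M.Cfg) (b i : ℕ) :
    pastCrossings f b (i + 1) = pastCrossings f b i ++ crossingState f b i := by
  simp [pastCrossings, List.range_succ]

theorem futureCrossings_eq (f : ℕ → M.Cfg) {l i : ℕ} (b : ℕ) (h : i < l) :
    futureCrossings f l b i = crossingState f b i ++ futureCrossings f l b (i + 1) := by
  obtain ⟨k, rfl⟩ := Nat.exists_eq_add_of_lt h
  rw [futureCrossings, futureCrossings, show i + k + 1 - i = k + 1 by omega,
    show i + k + 1 - (i + 1) = k by omega, List.range'_succ, List.flatMap_cons]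

theorem futureCrossings_self (f : ℕ → M.Cfg) (l b : ℕ) : futureCrossings f l b l = [] := by
  simp [futureCrossings]

theorem futureCrossings_zero (f : ℕ → M.Cfg) (l b : ℕ) :
    futureCrossings f l b 0 = pastCrossings f b l := by
  simp [futureCrossings, pastCrossings, List.range_eq_range']

theorem length_pastCrossings (f : ℕ → M.Cfg) (b i : ℕ) :
    (pastCrossings f b i).length =
      ∑ k ∈ Finset.range i, crossCount (f k).head (f (k + 1)).head b := by
  induction i with
  | zero => rfl
  | succ i ih =>
    rw [pastCrossings_succ, List.length_append, ih, Finset.sum_range_succ, crossingState,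
      crossCount]
    split <;> rfl

theorem length_pastCrossings_mono (f : ℕ → M.Cfg) (b : ℕ) {i l : ℕ} (h : i ≤ l) :
    (pastCrossings f b i).length ≤ (pastCrossings f b l).length := by
  rw [length_pastCrossings, length_pastCrossings]
  exact Finset.sum_le_sum_of_subset (by simpa using h)

/-- The status of square `b` in a configuration. -/
def statusOf (b : ℕ) (c : M.Cfg) : SquareStatus M.State :=
  if c.head = b then .inside c.state else if c.head < b then .onLeft else .onRight

/-- The configuration of the simulation of square `b` at time `i` of the path `f`, which has
length `l`. -/
def simCfgAt (f : ℕ → M.Cfg) (l b i : ℕ) : M.SimCfg where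
  pos := b
  sym := (f i).tape b
  status := statusOf b (f i)
  left := futureLeft f l b i
  right := pastCrossings f b i
  closed := !(pastCrossings f b i).isEmpty && (futureCrossings f l b i).isEmpty

/-- The condition is written with `+ 1` on the heads so that it also covers `b = 0`, where it is
never satisfied. -/
theorem futureLeft_eq_append (f : ℕ → M.Cfg) {l b i : ℕ} (h : i < l) :
    futureLeft f l b i =
      (if (f i).head + 1 = b ∧ (f (i + 1)).head = b ∨ (f i).head = b ∧ (f (i + 1)).head + 1 = b then
        [(f (i + 1)).state] else []) ++ futureLeft f l b (i + 1) := by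
  cases b with
  | zero =>
    rw [if_neg (by omega)]; rfl
  | succ b =>
    rw [futureLeft, futureLeft, futureCrossings_eq f b h, crossingState]
    simp only [Nat.add_right_cancel_iff]

/-- A move that neither starts nor ends on square `b` is invisible to its simulation; every other
move is one of the five kinds of `SquareMove`. -/
theorem simCfgAt_succ {x : List A} (f : ℕ → M.Cfg) {l b i : ℕ} (hi : i < l)
    (hs : M.Step (f i) (f (i + 1))) :
    simCfgAt f l b (i + 1) = simCfgAt f l b i ∨
      M.SimStep x (simCfgAt f l b i) (simCfgAt f l b (i + 1)) := by
  obtain ⟨ha, hr, s, m, hmem, ht, hm⟩ := hs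
  have hL := futureLeft_eq_append f (b := b) hi
  have hF := futureCrossings_eq f b hi
  have hP := pastCrossings_succ f b i
  rw [crossingState] at hF hP
  unfold simCfgAt statusOf
  by_cases hb : (f i).head = b
  · rw [hb] at ht hmem hm
    have hsym : (f (i + 1)).tape b = some s := by rw [ht, Function.update_self]
    cases m with
    | stay =>
      have hb' : (f (i + 1)).head = b := by simpa [HeadMove.apply, eq_comm] using hm
      right
      rw [if_neg (by omega), List.nil_append] at hL hF
      rw [if_neg (by omega), List.append_nil] at hP
      rw [hL, hF, hP, if_pos hb, if_pos hb', hsym]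
      exact .idle (.stay ha hr hmem)
    | right =>
      have hb' : (f (i + 1)).head = b + 1 := by simpa [HeadMove.apply, eq_comm] using hm
      right
      rw [if_neg (by omega), List.nil_append] at hL
      rw [if_pos (by omega)] at hF hP
      rw [hL, hF, hP, if_pos hb, if_neg (by omega), if_neg (by omega), hsym]
      -- The guess made here is the value of `closed` at time `i + 1`. Before the push `closed` is
      -- `false`, since this crossing is still to come.
      simpa using .push _ (.right ha hr hmem)
    | left =>
      obtain ⟨k, rfl⟩ : ∃ k, b = k + 1 :=
        Nat.exists_eq_succ_of_ne_zero (by rintro rfl; simp [HeadMove.apply] at hm)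
      have hb' : (f (i + 1)).head = k := by simpa [HeadMove.apply, eq_comm] using hm
      right
      rw [if_pos (by omega)] at hL
      rw [if_neg (by omega), List.nil_append] at hF
      rw [if_neg (by omega), List.append_nil] at hP
      rw [hL, hF, hP, if_pos hb, if_neg (by omega), if_pos (by omega), hsym]
      exact .pop (.left ha hr hmem)
  · have hsym : (f (i + 1)).tape b = (f i).tape b := by
      rw [ht, Function.update_of_ne (Ne.symm hb)]
    have hm' : (f (i + 1)).head = (f i).head ∨ (f (i + 1)).head = (f i).head + 1 ∨
        (f (i + 1)).head + 1 = (f i).head := by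
      generalize (f i).head = p at hm
      cases m <;> cases p <;> simp [HeadMove.apply] at hm <;> omega
    by_cases hb' : (f (i + 1)).head = b
    · right
      rcases Nat.lt_or_gt_of_ne hb with hlt | hgt
      · rw [if_pos (by omega)] at hL
        rw [if_neg (by omega), List.nil_append] at hF
        rw [if_neg (by omega), List.append_nil] at hP
        rw [hL, hF, hP, if_neg hb, if_pos hlt, if_pos hb', hsym]
        exact .pop (.enter _)
      · rw [if_neg (by omega), List.nil_append] at hL
        rw [if_pos (by omega)] at hF hP
        rw [hL, hF, hP, if_neg hb, if_neg (by omega), if_pos hb', hsym]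
        simpa using .push _ (.ret _)
    · left
      rw [if_neg (by omega), List.nil_append] at hL hF
      rw [if_neg (by omega), List.append_nil] at hP
      rw [hL, hF, hP, hsym, if_neg hb, if_neg hb']
      have : (f (i + 1)).head < b ↔ (f i).head < b := by omega
      simp only [this]

/-- Along an accepting path of `M` whose crossing sequences have length at most `k` the simulation
reaches a successful end. -/
theorem exists_simReach_of_path {x : List A} {f : ℕ → M.Cfg} {l k : ℕ} (h0 : f 0 = M.init x)
    (hs : ∀ i < l, M.Step (f i) (f (i + 1))) (ha : (f l).state ∈ M.accept) (hk : 1 ≤ k)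
    (hc : ∀ b, (pastCrossings f b l).length ≤ k) :
    ∃ a m, M.SimReach x a m ∧ m ≤ k ∧ a.Accepting := by
  have hfin (b : ℕ) : M.FinalStatus (statusOf b (f l)) := by
    unfold statusOf
    split_ifs
    exacts [ha, trivial, trivial]
  have hleft (b : ℕ) : futureLeft f l b l = [] := by
    cases b
    exacts [rfl, futureCrossings_self f l _]
  have hsquare (b : ℕ) (h : ∃ m ≤ k, M.SimReach x (simCfgAt f l b 0) m) (i : ℕ) (hi : i ≤ l) :
      ∃ m ≤ k, M.SimReach x (simCfgAt f l b i) m := by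
    induction i with
    | zero => exact h
    | succ i ih =>
      obtain ⟨m, hm, hreach⟩ := ih (by omega)
      rcases simCfgAt_succ (x := x) (b := b) f hi (hs i hi) with h | h
      · exact ⟨m, hm, h ▸ hreach⟩
      · exact ⟨_, max_le hm ((length_pastCrossings_mono f b hi).trans (hc b)), hreach.step h⟩
  have hstart (b : ℕ) (h : ∀ b' < b, pastCrossings f b' l ≠ []) :
      ∃ m ≤ k, M.SimReach x (simCfgAt f l b 0) m := by
    induction b with
    | zero =>
      refine ⟨1, hk, ?_⟩
      rw [show simCfgAt f l 0 0 = ⟨0, (M.init x).tape 0, .inside M.start, [], [], false⟩ by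
        simp [simCfgAt, h0, statusOf, init, futureLeft, pastCrossings]]
      exact .init
    | succ b ih =>
      obtain ⟨m, hm, hreach⟩ :=
        hsquare b (ih fun b' hb' => h b' (by omega)) l le_rfl
      have hne := h b (Nat.lt_succ_self b)
      refine ⟨m, hm, ?_⟩
      rw [show simCfgAt f l b l = ⟨b, (f l).tape b, statusOf b (f l), [], pastCrossings f b l, true⟩
        by simp [simCfgAt, hleft, futureCrossings_self, hne]] at hreach
      rw [show simCfgAt f l (b + 1) 0 =
          ⟨b + 1, (M.init x).tape (b + 1), .onLeft, pastCrossings f b l, [], false⟩ by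
        simp [simCfgAt, futureLeft, futureCrossings_zero, h0, statusOf, init, pastCrossings]]
      simpa [hreach.one_le] using hreach.step (.next (hfin b) hne)
  have hex : ∃ b, pastCrossings f b l = [] := by
    -- The sum bounds all head positions up to time `l`; crossing this boundary would need a larger
    -- one.
    refine ⟨∑ i ∈ Finset.range (l + 1), (f i).head, ?_⟩
    rw [← List.length_eq_zero_iff, length_pastCrossings, Finset.sum_eq_zero]
    intro i hi
    have hle (i : ℕ) (hi : i < l + 1) : (f i).head ≤ ∑ i ∈ Finset.range (l + 1), (f i).head :=
      Finset.single_le_sum (f := fun i => (f i).head) (fun _ _ => Nat.zero_le _)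
        (Finset.mem_range.2 hi)
    have hi := Finset.mem_range.1 hi
    have h₁ := hle i (by omega)
    have h₂ := hle (i + 1) (by omega)
    exact if_neg (by omega)
  classical
  -- The simulation ends at the leftmost boundary that is never crossed; all earlier sequences are
  -- nonempty, as `next` requires.
  obtain ⟨m, hm, hreach⟩ := hsquare _ (hstart (Nat.find hex) fun b' => Nat.find_min hex) l le_rfl
  exact ⟨_, m, hreach, hm, hleft _, Nat.find_spec hex, hfin _⟩

/-- For every accepting computation of `M` there is a successful simulation whose crossing
sequences are at most as long. -/
theorem exists_simReach {x : List A} (C : M.Comp x) (hC : M.Accepting x C) :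
    ∃ a m, M.SimReach x a m ∧ (m : ℕ∞) ≤ max 1 (M.crossingLength x C) ∧ a.Accepting := by
  obtain ⟨l, hl, ha⟩ := hC
  have hlen (b : ℕ) : ((pastCrossings C.cfg b l).length : ℕ∞) = (crossings C b).encard := by
    rw [length_pastCrossings, sum_crossCount_eq (fun i => (C.cfg i).head)]
    simp [crossings, hl]
  have hfin : M.crossingLength x C ≠ ⊤ := by
    refine ne_top_of_le_ne_top (ENat.natCast_ne_top l) (iSup_le fun b => ?_)
    rw [← hlen, length_pastCrossings, Nat.cast_le]
    refine (Finset.sum_le_card_nsmul _ _ 1 fun i _ => ?_).trans (by simp)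
    unfold crossCount
    split <;> omega
  obtain ⟨k, hk⟩ := ENat.ne_top_iff_exists.1 hfin
  obtain ⟨a, m, h, hm, hacc⟩ := exists_simReach_of_path (k := max 1 k) C.cfg_zero
    (fun i hi => C.step i (by rw [hl]; exact_mod_cast hi)) ha (le_max_left _ _) fun b =>
      le_max_of_le_right (by
        rw [← Nat.cast_le (α := ℕ∞), hlen, hk]
        exact le_iSup (fun b => (crossings C b).encard) b)
  refine ⟨a, m, h, ?_, hacc⟩
  rw [← hk]
  exact (le_max_iff.1 hm).elim (fun h => le_max_of_le_left (by exact_mod_cast h))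
    fun h => le_max_of_le_right (by exact_mod_cast h)

variable (M)

/-! ### The simulating machine

The worktape has two tracks, which contain the crossing sequences on the left and on the right of
the current square; their roles alternate. The leftmost square is marked, and so is the last state
of each crossing sequence. States of the left sequence are erased when they have been used. -/

/-- The worktape symbols: mark of the leftmost square, and content of the tracks. -/
abbrev SimWork : Type := Bool × (Bool → Option (M.State × Bool))

/-- The data in the finite control during the simulation of a square. -/
structure SimControl where
  track : Bool
  leftEmpty : Bool
  rightEmpty : Bool
  closed : Bool
  sym : Option M.Sym
  status : SquareStatus M.State

/-- The states of the simulating machine. -/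
inductive SimState where
  | start
  | accept
  | load (k : M.SimControl)
  | main (k : M.SimControl)
  | rewind (k : M.SimControl)
  | push (q : M.State) (k : M.SimControl)
  | pop (q : M.State) (k : M.SimControl)

instance {Q : Type} [Finite Q] : Finite (SquareStatus Q) :=
  Finite.of_surjective (α := Option (Option Q))
    (fun | none => .onLeft | some none => .onRight | some (some q) => .inside q)
    fun | .onLeft => ⟨none, rfl⟩ | .onRight => ⟨some none, rfl⟩ | .inside q => ⟨some (some q), rfl⟩

instance : Finite M.SimControl :=
  have := M.finite_state
  have := M.finite_sym
  Finite.of_surjective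
    (α := Bool × Bool × Bool × Bool × Option M.Sym × SquareStatus M.State)
    (fun k => ⟨k.1, k.2.1, k.2.2.1, k.2.2.2.1, k.2.2.2.2.1, k.2.2.2.2.2⟩)
    fun k => ⟨⟨k.track, k.leftEmpty, k.rightEmpty, k.closed, k.sym, k.status⟩, rfl⟩

instance : Finite M.SimState :=
  have := M.finite_state
  Finite.of_surjective
    (α := Option (Option (M.SimControl ⊕ M.SimControl ⊕ M.SimControl ⊕
      (M.State × M.SimControl) ⊕ (M.State × M.SimControl))))
    (fun
      | none => .start
      | some none => .accept
      | some (some (.inl k)) => .load k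
      | some (some (.inr (.inl k))) => .main k
      | some (some (.inr (.inr (.inl k)))) => .rewind k
      | some (some (.inr (.inr (.inr (.inl p))))) => .push p.1 p.2
      | some (some (.inr (.inr (.inr (.inr p))))) => .pop p.1 p.2)
    fun
      | .start => ⟨none, rfl⟩
      | .accept => ⟨some none, rfl⟩
      | .load k => ⟨some (some (.inl k)), rfl⟩
      | .main k => ⟨some (some (.inr (.inl k))), rfl⟩
      | .rewind k => ⟨some (some (.inr (.inr (.inl k)))), rfl⟩
      | .push q k => ⟨some (some (.inr (.inr (.inr (.inl (q, k)))))), rfl⟩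
      | .pop q k => ⟨some (some (.inr (.inr (.inr (.inr (q, k)))))), rfl⟩

/-- The initial content of a square of the one-tape machine. -/
def inputContent : InputSym A → Option M.Sym
  | .sym a => some (M.input a)
  | _ => none

/-- The input head advances until it reaches the right endmarker. -/
def _root_.InputSym.advance : InputSym A → HeadMove
  | .rightEnd => .stay
  | _ => .right

/-- The transitions of the simulating machine. -/
inductive SimTrans :
    M.SimState → InputSym A → M.SimWork → M.SimState × M.SimWork × HeadMove × HeadMove → Prop
  | start (a v) : SimTrans .start a v
      (.load ⟨false, true, true, false, none, .inside M.start⟩, (true, v.2), .right, .stay)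
  | load (k a v) : SimTrans (.load k) a v
      (.main { k with sym := M.inputContent a }, v, .stay, .stay)
  | idle {k s t} (a v) : M.SquareMove k.sym k.status .idle s t → SimTrans (.main k) a v
      (.main { k with sym := s, status := t }, v, .stay, .stay)
  | push {k q s t} (e a v) : M.SquareMove k.sym k.status (.push q) s t → k.closed = false →
      SimTrans (.main k) a v
        (.push q { k with sym := s, status := t, rightEmpty := false, closed := e }, v,
          .stay, .stay)
  -- A nonempty left sequence ensures that the search on its track ends within the space already
  -- accounted for.
  | pop {k q s t} (a v) : M.SquareMove k.sym k.status (.pop q) s t → k.leftEmpty = false →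
      SimTrans (.main k) a v (.pop q { k with sym := s, status := t }, v, .stay, .stay)
  | next {k} (a v) : M.FinalStatus k.status → k.leftEmpty = true → k.rightEmpty = false →
      k.closed = true → SimTrans (.main k) a v
        (.load ⟨!k.track, false, true, false, none, .onLeft⟩, v, a.advance, .stay)
  | accept {k} (a v) : M.FinalStatus k.status → k.leftEmpty = true → k.rightEmpty = true →
      SimTrans (.main k) a v (.accept, v, .stay, .stay)
  | pushSeek {q k v} (a) : v.2 (!k.track) ≠ none →
      SimTrans (.push q k) a v (.push q k, v, .stay, .right)
  | pushWrite {q k v} (a) : v.2 (!k.track) = none → SimTrans (.push q k) a v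
      (.rewind k, (v.1, Function.update v.2 (!k.track) (some (q, k.closed))), .stay, .stay)
  | popSeek {q k v} (a) : v.2 k.track = none →
      SimTrans (.pop q k) a v (.pop q k, v, .stay, .right)
  -- A state other than the predicted `q` blocks the computation. The mark `e` tells whether the
  -- sequence is now used up.
  | popErase {q k v e} (a) : v.2 k.track = some (q, e) → SimTrans (.pop q k) a v
      (.rewind { k with leftEmpty := e }, (v.1, Function.update v.2 k.track none), .stay, .stay)
  | rewind {k v} (a) : v.1 = false → SimTrans (.rewind k) a v (.rewind k, v, .stay, .left)
  | home {k v} (a) : v.1 = true → SimTrans (.rewind k) a v (.main k, v, .stay, .stay)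

/-- A one-way standard machine that guesses and checks the crossing sequences of `M` from left to
right. -/
abbrev simulator : StandardTM A where
  State := M.SimState
  Work := M.SimWork
  finite_state := inferInstance
  finite_work := have := M.finite_state; inferInstance
  blank := (false, fun _ => none)
  start := .start
  accept := {.accept}
  reject := ∅
  disjoint := by simp
  trans p a v := {t | M.SimTrans p a v t}

theorem simulator_oneWay : M.simulator.OneWay := by
  intro p a v t ht
  have ht : M.SimTrans p a v t := ht
  cases ht with
  | next => cases a <;> simp [InputSym.advance]
  | _ => simp

variable {M}

/-! ### Encoding of the crossing sequences on the worktape -/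

/-- A crossing sequence in which the last state is marked if `e` holds. -/
def markLast (e : Bool) : List M.State → List (M.State × Bool)
  | [] => []
  | q :: L => (q, L.isEmpty && e) :: markLast e L

theorem length_markLast (e : Bool) (L : List M.State) : (markLast e L).length = L.length := by
  induction L with
  | nil => rfl
  | cons q L ih => simp [markLast, ih]

theorem markLast_append (e : Bool) (L : List M.State) (q : M.State) :
    markLast e (L ++ [q]) = markLast false L ++ [(q, e)] := by
  induction L with
  | nil => simp [markLast]
  | cons q' L ih => simp [markLast, ih]

/-- The worktape on which the track `t` contains `L` from square `i` on, and the other one contains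
`R`. -/
def encTape (t : Bool) (i : ℕ) (L R : List (M.State × Bool)) (p : ℕ) : M.SimWork :=
  (decide (p = 0), fun u => if u = t then if p < i then none else L[p - i]? else R[p]?)

/-- A used up track is blank throughout, so the tracks can exchange their roles without any change
of the tape. -/
theorem encTape_nil (t : Bool) (i : ℕ) (R : List (M.State × Bool)) :
    encTape (M := M) t i [] R = encTape (!t) 0 R [] := by
  funext p
  refine Prod.ext rfl (funext fun u => ?_)
  cases u <;> cases t <;> simp [encTape]

theorem update_encTape_push (t : Bool) (i : ℕ) (L R : List (M.State × Bool))
    (g : M.State × Bool) :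
    Function.update (encTape (M := M) t i L R) R.length
        ((encTape (M := M) t i L R R.length).1,
          Function.update (encTape (M := M) t i L R R.length).2 (!t) (some g)) =
      encTape t i L (R ++ [g]) := by
  funext p
  rcases eq_or_ne p R.length with rfl | hp
  · rw [Function.update_self]
    refine Prod.ext rfl (funext fun u => ?_)
    cases u <;> cases t <;> simp [encTape]
  · rw [Function.update_of_ne hp]
    refine Prod.ext rfl (funext fun u => ?_)
    dsimp only [encTape]
    congr 1
    rw [List.getElem?_append]
    split
    · rfl
    · rw [List.getElem?_eq_none (by omega), List.getElem?_eq_none (by simp; omega)]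

theorem update_encTape_pop (t : Bool) (i : ℕ) (L R : List (M.State × Bool))
    (g : M.State × Bool) :
    Function.update (encTape (M := M) t i (g :: L) R) i
        ((encTape (M := M) t i (g :: L) R i).1,
          Function.update (encTape (M := M) t i (g :: L) R i).2 t none) =
      encTape t (i + 1) L R := by
  funext p
  rcases eq_or_ne p i with rfl | hp
  · rw [Function.update_self]
    refine Prod.ext rfl (funext fun u => ?_)
    cases u <;> cases t <;> simp [encTape]
  · rw [Function.update_of_ne hp]
    refine Prod.ext rfl (funext fun u => ?_)
    dsimp only [encTape]
    congr 1
    rcases Nat.lt_or_gt_of_ne hp with h | h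
    · rw [if_pos h, if_pos (by omega)]
    · rw [if_neg (by omega), if_neg (by omega), show p - i = p - (i + 1) + 1 by omega,
        List.getElem?_cons_succ]

theorem encTape_left (t : Bool) (i : ℕ) (L R : List (M.State × Bool)) (p : ℕ) :
    (encTape (M := M) t i L R p).2 t = if p < i then none else L[p - i]? := by
  simp [encTape]

theorem encTape_right (t : Bool) (i : ℕ) (L R : List (M.State × Bool)) (p : ℕ) :
    (encTape (M := M) t i L R p).2 (!t) = R[p]? := by
  simp [encTape]

/-- The position of the input head while the square `b` is simulated. -/
def inputPos (x : List A) (b : ℕ) : ℕ := min b x.length + 1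

/-- Square `b` of `M` corresponds to square `b + 1` of the input tape; from the end of the input on,
the right endmarker stands for the blank. -/
theorem inputContent_inputAt (x : List A) (b : ℕ) :
    M.inputContent (inputAt x (inputPos x b)) = (M.init x).tape b := by
  rcases lt_or_ge b x.length with h | h
  · simp [inputPos, min_eq_left h.le, inputAt, init, h, inputContent]
  · simp [inputPos, inputAt, init, h, inputContent]

theorem advance_apply_inputPos (x : List A) (b : ℕ) :
    (inputAt x (inputPos x b)).advance.apply (inputPos x b) = some (inputPos x (b + 1)) := by
  rcases lt_or_ge b x.length with h | h
  · simp [inputPos, min_eq_left h.le, inputAt, h, InputSym.advance, HeadMove.apply]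
  · simp [inputPos, min_eq_right h, inputAt, InputSym.advance, HeadMove.apply,
      min_eq_right (Nat.le_succ_of_le h)]

theorem inputPos_le (x : List A) (b : ℕ) : inputPos x b ≤ x.length + 1 := by
  simp [inputPos]

/-! ### Computations of the simulating machine follow the abstract simulation -/

/-- The content of the finite control that represents a configuration of the simulation. -/
def SimCfg.control (t : Bool) (a : M.SimCfg) : M.SimControl :=
  ⟨t, a.left.isEmpty, a.right.isEmpty, a.closed, a.sym, a.status⟩

/-- The configurations of the simulating machine in which a given configuration of the simulation
is represented. -/
abbrev simulatorCfg (x : List A) (q : M.SimState) (b : ℕ) (T : ℕ → M.SimWork) (h : ℕ) :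
    M.simulator.Cfg := ⟨q, inputPos x b, T, h⟩

/-- The invariant of the simulating machine: it represents a reachable configuration of the
simulation with crossing sequences of length at most `m`. -/
inductive SimulatorInv (x : List A) : M.simulator.Cfg → ℕ → Prop
  | start : SimulatorInv x M.simulator.init 1
  | load {b s L u m} (t) : M.SimReach x ⟨b, (M.init x).tape b, u, L, [], false⟩ m →
      L.length ≤ m → SimulatorInv x (simulatorCfg x
        (.load (SimCfg.control t ⟨b, s, u, L, [], false⟩)) b (encTape t 0 (markLast true L) []) 0) m
  -- The squares `< i` of the left track have been erased, so the left sequence ends before square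
  -- `i + a.left.length`.
  | main {a m i} (t) : M.SimReach x a m → i + a.left.length ≤ m → SimulatorInv x (simulatorCfg x
      (.main (a.control t)) a.pos (encTape t i (markLast true a.left) (markLast a.closed a.right))
      0) m
  | rewind {a m i h} (t) : M.SimReach x a m → i + a.left.length ≤ m → h < m →
      SimulatorInv x (simulatorCfg x (.rewind (a.control t)) a.pos
        (encTape t i (markLast true a.left) (markLast a.closed a.right)) h) m
  | push {b s u L R e q m i h} (t) : M.SimReach x ⟨b, s, u, L, R ++ [q], e⟩ m →
      i + L.length ≤ m → h ≤ R.length → SimulatorInv x (simulatorCfg x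
        (.push q (SimCfg.control t ⟨b, s, u, L, R ++ [q], e⟩)) b
        (encTape t i (markLast true L) (markLast false R)) h) m
  -- The control already shows the outcome of the move, but the state is not yet checked; hence
  -- reachability refers to the configuration before it.
  | pop {b s u s' u' L R e q m i h} (t) : M.SimReach x ⟨b, s, u, L, R, e⟩ m →
      M.SquareMove s u (.pop q) s' u' → L ≠ [] → i + L.length ≤ m → h ≤ i →
      SimulatorInv x (simulatorCfg x (.pop q (SimCfg.control t ⟨b, s', u', L, R, e⟩)) b
        (encTape t i (markLast true L) (markLast e R)) h) m
  | accept {a m T} : M.SimReach x a m → a.Accepting →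
      SimulatorInv x (simulatorCfg x .accept a.pos T 0) m

/-- The space bound: a pushing head goes at most to the place of the new state, a popping one at
most to the first remaining state. -/
theorem SimulatorInv.head_lt {x : List A} {c : M.simulator.Cfg} {m : ℕ}
    (h : SimulatorInv x c m) : c.head < m := by
  cases h with
  | start => exact Nat.one_pos
  | load _ h => exact h.one_le
  | main _ h => exact h.one_le
  | rewind _ _ _ h => exact h
  | push _ h _ hh =>
    have := h.right_le
    simp at this
    exact hh.trans_lt this
  | pop _ _ _ hL hi hh =>
    have := List.length_pos_iff.2 hL
    dsimp only [simulatorCfg]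
    omega
  | accept h => exact h.one_le

theorem SimReach.step_of_le {x : List A} {a a' : M.SimCfg} {m : ℕ} (h : M.SimReach x a m)
    (hs : M.SimStep x a a') (hm : a'.right.length ≤ m) : M.SimReach x a' m := by
  simpa [hm] using h.step hs

theorem simulator_init_tape :
    Function.update M.simulator.init.tape M.simulator.init.head
      (true, (M.simulator.init.tape M.simulator.init.head).2) = encTape false 0 [] [] := by
  funext p
  rcases eq_or_ne p 0 with rfl | hp
  · simp [StandardTM.init, simulator, encTape]
  · simp [StandardTM.init, simulator, encTape, hp]

/-- The bound `m` changes only when `main` starts a push, the one operation that lengthens a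
sequence. -/
theorem SimulatorInv.step {x : List A} {c d : M.simulator.Cfg} {m : ℕ}
    (h : SimulatorInv x c m) (hs : M.simulator.Step x c d) :
    ∃ m', m ≤ m' ∧ SimulatorInv x d m' := by
  obtain ⟨hacc, -, w, mi, mw, htr, hT, hi, -, hw⟩ := hs
  have htr : M.SimTrans c.state (inputAt x c.inputHead) (c.tape c.head) (d.state, w, mi, mw) := htr
  obtain ⟨q, p, T, h'⟩ := d
  dsimp only at *
  subst hT
  cases h with
  | start =>
    cases htr with
    | start =>
      obtain rfl : 1 = p := by simpa [StandardTM.init, HeadMove.apply] using hi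
      obtain rfl : 0 = h' := by simpa [StandardTM.init, HeadMove.apply] using hw
      refine ⟨1, le_rfl, ?_⟩
      rw [simulator_init_tape]
      exact .load (s := none) false .init (by simp)
  | @load b s L u m t hr hL =>
    cases htr with
    | load =>
      obtain rfl : inputPos x b = p := by simpa [simulatorCfg, HeadMove.apply] using hi
      obtain rfl : 0 = h' := by simpa [simulatorCfg, HeadMove.apply] using hw
      refine ⟨m, le_rfl, ?_⟩
      rw [Function.update_eq_self, simulatorCfg, inputContent_inputAt]
      exact .main t hr (by simpa using hL)
  | @main a m i t hr hL =>
    obtain ⟨b, s, u, L, R, e⟩ := a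
    have hR := hr.right_le
    dsimp only [simulatorCfg, SimCfg.control] at *
    cases htr with
    | @idle _ s' u' _ _ hmove =>
      obtain rfl : inputPos x b = p := by simpa [HeadMove.apply] using hi
      obtain rfl : 0 = h' := by simpa [HeadMove.apply] using hw
      refine ⟨m, le_rfl, ?_⟩
      rw [Function.update_eq_self]
      exact .main (a := ⟨b, s', u', L, R, e⟩) t (hr.step_of_le (.idle hmove) hR) hL
    | @push _ q s' u' e' _ _ hmove he =>
      obtain rfl : inputPos x b = p := by simpa [HeadMove.apply] using hi
      obtain rfl : 0 = h' := by simpa [HeadMove.apply] using hw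
      obtain rfl : e = false := he
      refine ⟨max m (R ++ [q]).length, le_max_left _ _, ?_⟩
      rw [Function.update_eq_self]
      have := SimulatorInv.push (h := 0) t (hr.step (.push e' hmove)) (le_max_of_le_left hL)
        (Nat.zero_le _)
      have hne : (R ++ [q]).isEmpty = false := by simp
      rwa [SimCfg.control, hne] at this
    | @pop _ q s' u' _ _ hmove he =>
      obtain rfl : inputPos x b = p := by simpa [HeadMove.apply] using hi
      obtain rfl : 0 = h' := by simpa [HeadMove.apply] using hw
      refine ⟨m, le_rfl, ?_⟩
      rw [Function.update_eq_self]
      exact .pop t hr hmove (by simpa using he) hL (Nat.zero_le _)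
    | next _ _ hu hLe hRe he =>
      obtain rfl : inputPos x (b + 1) = p := by
        rw [advance_apply_inputPos] at hi
        exact Option.some.inj hi
      obtain rfl : 0 = h' := by simpa [HeadMove.apply] using hw
      obtain rfl : L = [] := by simpa using hLe
      obtain rfl : e = true := he
      refine ⟨m, le_rfl, ?_⟩
      rw [Function.update_eq_self, markLast, encTape_nil]
      have := SimulatorInv.load (s := none) (!t)
        (hr.step_of_le (.next hu (by simpa using hRe)) (Nat.zero_le _)) hR
      rwa [SimCfg.control, show R.isEmpty = false from hRe] at this
    | accept _ _ hu hLe hRe =>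
      obtain rfl : 0 = h' := by simpa [HeadMove.apply] using hw
      obtain rfl : inputPos x b = p := by simpa [HeadMove.apply] using hi
      exact ⟨m, le_rfl, .accept hr ⟨by simpa using hLe, by simpa using hRe, hu⟩⟩
  | @rewind a m i h t hr hL hh =>
    dsimp only [simulatorCfg] at *
    cases htr with
    | rewind _ h0 =>
      obtain rfl : inputPos x a.pos = p := by simpa [HeadMove.apply] using hi
      obtain ⟨h, rfl⟩ : ∃ k, h = k + 1 :=
        Nat.exists_eq_succ_of_ne_zero (by rintro rfl; simp [encTape] at h0)
      obtain rfl : h = h' := by simpa [HeadMove.apply] using hw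
      refine ⟨m, le_rfl, ?_⟩
      rw [Function.update_eq_self]
      exact .rewind t hr hL (by omega)
    | home _ h0 =>
      obtain rfl : inputPos x a.pos = p := by simpa [HeadMove.apply] using hi
      obtain rfl : h = 0 := by simpa [encTape] using h0
      obtain rfl : 0 = h' := by simpa [HeadMove.apply] using hw
      refine ⟨m, le_rfl, ?_⟩
      rw [Function.update_eq_self]
      exact .main t hr hL
  | @push b s u L R e q m i h t hr hL hh =>
    have hR := hr.right_le
    dsimp only [simulatorCfg] at *
    rw [List.length_append, List.length_singleton] at hR
    cases htr with
    | pushSeek _ h0 =>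
      obtain rfl : inputPos x b = p := by simpa [HeadMove.apply] using hi
      obtain rfl : h + 1 = h' := by simpa [HeadMove.apply] using hw
      refine ⟨m, le_rfl, ?_⟩
      rw [Function.update_eq_self]
      have : h < R.length := by
        simpa [SimCfg.control, encTape_right, length_markLast] using h0
      exact .push t hr hL this
    | pushWrite _ h0 =>
      obtain rfl : inputPos x b = p := by simpa [HeadMove.apply] using hi
      obtain rfl : h = h' := by simpa [HeadMove.apply] using hw
      refine ⟨m, le_rfl, ?_⟩
      have : R.length ≤ h := by
        simpa [SimCfg.control, encTape_right, length_markLast] using h0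
      obtain rfl : h = (markLast false R).length := by rw [length_markLast]; omega
      dsimp only [SimCfg.control]
      rw [update_encTape_push, ← markLast_append]
      refine .rewind (a := ⟨b, s, u, L, R ++ [q], e⟩) t hr hL ?_
      rw [length_markLast]; omega
  | @pop b s u s' u' L R e q m i h t hr hmove hne hL hh =>
    have hR := hr.right_le
    obtain ⟨q', L, rfl⟩ := List.exists_cons_of_ne_nil hne
    rw [List.length_cons] at hL
    dsimp only [simulatorCfg] at *
    cases htr with
    | popSeek _ h0 =>
      obtain rfl : inputPos x b = p := by simpa [HeadMove.apply] using hi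
      obtain rfl : h + 1 = h' := by simpa [HeadMove.apply] using hw
      refine ⟨m, le_rfl, ?_⟩
      rw [Function.update_eq_self]
      have : h ≠ i := by
        rintro rfl
        simp [SimCfg.control, encTape_left, markLast] at h0
      exact .pop t hr hmove hne hL (by omega)
    | @popErase _ _ _ e' _ h0 =>
      obtain rfl : inputPos x b = p := by simpa [HeadMove.apply] using hi
      obtain rfl : h = h' := by simpa [HeadMove.apply] using hw
      refine ⟨m, le_rfl, ?_⟩
      obtain rfl : h = i := by
        by_contra hne
        simp [SimCfg.control, encTape_left, show h < i by omega] at h0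
      obtain ⟨rfl, rfl⟩ : q' = q ∧ L.isEmpty = e' := by
        simpa [SimCfg.control, encTape_left, markLast] using h0
      dsimp only [SimCfg.control, markLast]
      rw [update_encTape_pop]
      exact .rewind (a := ⟨b, s', u', L, R, e⟩) t (hr.step_of_le (.pop hmove) hR)
        (by dsimp only; omega) (by omega)
  | accept => exact absurd rfl hacc

/-- Every accepting computation of the simulating machine comes from an accepting computation of
`M` whose crossing sequences are at least as long as the space used. -/
theorem exists_comp_of_simulator {x : List A} (C : M.simulator.Comp x)
    (hC : M.simulator.Accepting x C) :
    ∃ D : M.Comp x, M.Accepting x D ∧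
      M.simulator.space x C ≤ max 1 (M.crossingLength x D) := by
  obtain ⟨l, hl, ha⟩ := hC
  have hinv (i : ℕ) (hi : i ≤ l) :
      ∃ m, SimulatorInv x (C.cfg i) m ∧ ∀ j ≤ i, (C.cfg j).head < m := by
    induction i with
    | zero =>
      refine ⟨1, by rw [C.cfg_zero]; exact .start, fun j hj => ?_⟩
      rw [Nat.le_zero.1 hj, C.cfg_zero]
      exact Nat.one_pos
    | succ i ih =>
      obtain ⟨m, h, hm⟩ := ih (by omega)
      obtain ⟨m', hmm, h'⟩ := h.step (C.step i (by rw [hl]; exact_mod_cast hi))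
      refine ⟨m', h', fun j hj => ?_⟩
      rcases Nat.le_succ_iff.1 hj with hj | rfl
      · exact (hm j hj).trans_le hmm
      · exact h'.head_lt
  obtain ⟨m, h, hm⟩ := hinv l le_rfl
  obtain ⟨a, hr, hacc⟩ : ∃ a, M.SimReach x a m ∧ a.Accepting := by
    have ha : (C.cfg l).state = SimState.accept := ha
    generalize C.cfg l = c at h ha
    cases h with
    | accept hr hacc => exact ⟨_, hr, hacc⟩
    | _ => cases ha
  obtain ⟨D, hD, hmD⟩ := hr.exists_comp hacc
  refine ⟨D, hD, le_trans ?_ hmD⟩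
  rw [StandardTM.space, hl]
  refine (Set.encard_le_encard (t := Finset.range m) ?_).trans
    (by rw [Set.encard_coe_eq_coe_finsetCard, Finset.card_range])
  rintro p ⟨i, hi, rfl⟩
  simpa using hm i (by exact_mod_cast hi)

/-! ### The simulating machine carries out every abstract simulation -/

/-- Reachability of configurations of the simulating machine on the worktape squares `< k`. -/
def SimulatorReach (x : List A) (k : ℕ) : M.simulator.Cfg → M.simulator.Cfg → Prop :=
  Relation.ReflTransGen fun c d => M.simulator.Step x c d ∧ d.head < k

theorem SimulatorReach.tail_step {x : List A} {k b b' h h' : ℕ} {c : M.simulator.Cfg}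
    {q q' : M.SimState} {T : ℕ → M.SimWork} {w : M.SimWork} {mi mw : HeadMove}
    (hc : SimulatorReach x k c (simulatorCfg x q b T h))
    (ht : M.SimTrans q (inputAt x (inputPos x b)) (T h) (q', w, mi, mw)) (hq : q ≠ .accept)
    (hi : mi.apply (inputPos x b) = some (inputPos x b')) (hw : mw.apply h = some h')
    (hk : h' < k) :
    SimulatorReach x k c (simulatorCfg x q' b' (Function.update T h w) h') :=
  hc.tail ⟨⟨hq, id, w, mi, mw, ht, rfl, hi, inputPos_le x b', hw⟩, hk⟩

theorem SimulatorReach.tail_move {x : List A} {k b b' h h' : ℕ} {c : M.simulator.Cfg}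
    {q q' : M.SimState} {T : ℕ → M.SimWork} {mi mw : HeadMove}
    (hc : SimulatorReach x k c (simulatorCfg x q b T h))
    (ht : M.SimTrans q (inputAt x (inputPos x b)) (T h) (q', T h, mi, mw)) (hq : q ≠ .accept)
    (hi : mi.apply (inputPos x b) = some (inputPos x b')) (hw : mw.apply h = some h')
    (hk : h' < k) :
    SimulatorReach x k c (simulatorCfg x q' b' T h') := by
  simpa using hc.tail_step ht hq hi hw hk

theorem _root_.HeadMove.stay_apply (p : ℕ) : HeadMove.stay.apply p = some p := by
  cases p <;> rfl

theorem _root_.HeadMove.right_apply (p : ℕ) : HeadMove.right.apply p = some (p + 1) := by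
  cases p <;> rfl

theorem SimulatorReach.rewind {x : List A} {k b i h : ℕ} {c : M.simulator.Cfg}
    {K : M.SimControl} {t : Bool} {L R : List (M.State × Bool)} (hk : h < k)
    (hc : SimulatorReach x k c (simulatorCfg x (.rewind K) b (encTape t i L R) h)) :
    SimulatorReach x k c (simulatorCfg x (.main K) b (encTape t i L R) 0) := by
  induction h with
  | zero =>
    exact hc.tail_move (.home _ rfl) (by simp) (HeadMove.stay_apply _) (HeadMove.stay_apply _) hk
  | succ h ih =>
    exact ih (by omega) (hc.tail_move (.rewind _ (by simp [encTape])) (by simp)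
      (HeadMove.stay_apply _) rfl (by omega))

theorem SimulatorReach.pushSeek {x : List A} {k b i h : ℕ} {c : M.simulator.Cfg} {q : M.State}
    {K : M.SimControl} {L R : List (M.State × Bool)} (hh : h ≤ R.length) (hk : R.length < k)
    (hc : SimulatorReach x k c (simulatorCfg x (.push q K) b (encTape K.track i L R) 0)) :
    SimulatorReach x k c (simulatorCfg x (.push q K) b (encTape K.track i L R) h) := by
  induction h with
  | zero => exact hc
  | succ h ih =>
    refine (ih (by omega)).tail_move (.pushSeek _ ?_) (by simp) (HeadMove.stay_apply _)
      (HeadMove.right_apply h) (by omega)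
    rw [encTape_right, List.getElem?_eq_getElem (by omega)]
    simp

theorem SimulatorReach.popSeek {x : List A} {k b i h : ℕ} {c : M.simulator.Cfg} {q : M.State}
    {K : M.SimControl} {L R : List (M.State × Bool)} (hh : h ≤ i) (hk : i < k)
    (hc : SimulatorReach x k c (simulatorCfg x (.pop q K) b (encTape K.track i L R) 0)) :
    SimulatorReach x k c (simulatorCfg x (.pop q K) b (encTape K.track i L R) h) := by
  induction h with
  | zero => exact hc
  | succ h ih =>
    refine (ih (by omega)).tail_move (.popSeek _ ?_) (by simp) (HeadMove.stay_apply _)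
      (HeadMove.right_apply h) (by omega)
    rw [encTape_left, if_pos (by omega)]

theorem SimulatorReach.push {x : List A} {k b i : ℕ} {c : M.simulator.Cfg} {q : M.State}
    {K : M.SimControl} {L : List (M.State × Bool)} {R : List M.State} (hk : R.length < k)
    (hc : SimulatorReach x k c
      (simulatorCfg x (.push q K) b (encTape K.track i L (markLast false R)) 0)) :
    SimulatorReach x k c
      (simulatorCfg x (.main K) b (encTape K.track i L (markLast K.closed (R ++ [q]))) 0) := by
  rw [← length_markLast false] at hk
  have := (hc.pushSeek le_rfl hk).tail_step (.pushWrite _ (by simp [encTape_right])) (by simp)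
    (HeadMove.stay_apply _) (HeadMove.stay_apply _) hk
  rw [update_encTape_push, ← markLast_append] at this
  exact this.rewind hk

theorem SimulatorReach.pop {x : List A} {k b i : ℕ} {c : M.simulator.Cfg} {q : M.State} {e : Bool}
    {K : M.SimControl} {L R : List (M.State × Bool)} (hk : i < k)
    (hc : SimulatorReach x k c
      (simulatorCfg x (.pop q K) b (encTape K.track i ((q, e) :: L) R) 0)) :
    SimulatorReach x k c
      (simulatorCfg x (.main { K with leftEmpty := e }) b (encTape K.track (i + 1) L R) 0) := by
  have := (hc.popSeek le_rfl hk).tail_step (.popErase _ (e := e) (by simp [encTape_left]))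
    (by simp) (HeadMove.stay_apply _) (HeadMove.stay_apply _) hk
  rw [update_encTape_pop] at this
  exact this.rewind hk

theorem SimulatorReach.load {x : List A} {k b : ℕ} {c : M.simulator.Cfg} {T : ℕ → M.SimWork}
    {t lE rE e : Bool} {s : Option M.Sym} {u : SquareStatus M.State} (hk : 0 < k)
    (hc : SimulatorReach x k c (simulatorCfg x (.load ⟨t, lE, rE, e, s, u⟩) b T 0)) :
    SimulatorReach x k c
      (simulatorCfg x (.main ⟨t, lE, rE, e, (M.init x).tape b, u⟩) b T 0) := by
  have := hc.tail_move (.load _ _ _) (by simp) (HeadMove.stay_apply _) (HeadMove.stay_apply _) hk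
  rwa [inputContent_inputAt] at this

/-- The simulating machine reaches all configurations of the simulation, in the space given by the
crossing sequences. -/
theorem SimReach.simulatorReach {x : List A} {a : M.SimCfg} {m k : ℕ} (h : M.SimReach x a m)
    (hk : m ≤ k) :
    ∃ t i, i + a.left.length ≤ k ∧ SimulatorReach x k M.simulator.init
      (simulatorCfg x (.main (a.control t)) a.pos
        (encTape t i (markLast true a.left) (markLast a.closed a.right)) 0) := by
  induction h with
  | init =>
    refine ⟨false, 0, Nat.zero_le _, SimulatorReach.load (s := none) hk ?_⟩
    refine .tail .refl
      ⟨⟨by simp [StandardTM.init], id, _, .right, .stay, .start _ _, ?_, ?_, ?_, rfl⟩, hk⟩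
    · exact simulator_init_tape.symm
    · simp [inputPos, StandardTM.init, HeadMove.right_apply]
    · exact inputPos_le x 0
  | @step a a' m h hs ih =>
    obtain ⟨hm, hR'⟩ := max_le_iff.1 hk
    obtain ⟨t, i, hi, hc⟩ := ih hm
    have hk₀ : 0 < k := h.one_le.trans hm
    have hR := h.right_le
    cases hs with
    | idle hmove =>
      exact ⟨t, i, hi, hc.tail_move (.idle _ _ hmove) (by simp) (HeadMove.stay_apply _)
        (HeadMove.stay_apply _) hk₀⟩
    | @push b s u s' u' L R q e hmove =>
      rw [List.length_append] at hR'
      refine ⟨t, i, hi, ?_⟩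
      have := (hc.tail_move (.push e _ _ hmove rfl) (by simp) (HeadMove.stay_apply _)
        (HeadMove.stay_apply _) hk₀).push hR'
      have hne : (R ++ [q]).isEmpty = false := by simp
      rwa [SimCfg.control, hne]
    | @pop b s u s' u' L R q e hmove =>
      rw [List.length_cons] at hi
      refine ⟨t, i + 1, by dsimp only; omega, ?_⟩
      have := hc.tail_move (.pop _ _ hmove rfl) (by simp) (HeadMove.stay_apply _)
        (HeadMove.stay_apply _) hk₀
      simpa [SimCfg.control] using this.pop (by omega)
    | @next b s u R hu hne =>
      refine ⟨!t, 0, by simpa using hR.trans hm, ?_⟩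
      have := (hc.tail_move (.next _ _ hu rfl (by simpa [SimCfg.control] using hne) rfl) (by simp)
        (advance_apply_inputPos x b) (HeadMove.stay_apply _) hk₀).load hk₀
      rw [markLast, encTape_nil] at this
      rw [SimCfg.control, show R.isEmpty = false by simpa using hne]
      exact this

theorem exists_path_of_reflTransGen {α : Type*} {r : α → α → Prop} {a b : α}
    (h : Relation.ReflTransGen r a b) :
    ∃ (l : ℕ) (f : ℕ → α), f 0 = a ∧ f l = b ∧ ∀ i < l, r (f i) (f (i + 1)) := by
  induction h using Relation.ReflTransGen.head_induction_on with
  | refl => exact ⟨0, fun _ => b, rfl, rfl, by simp⟩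
  | @head a c hac _ ih =>
    obtain ⟨l, f, rfl, h1, h2⟩ := ih
    refine ⟨l + 1, fun i => Nat.casesOn i a f, rfl, h1, ?_⟩
    rintro (_ | i) hi
    · exact hac
    · exact h2 i (by omega)

/-- For every accepting computation of `M` there is an accepting computation of the simulating
machine whose space is at most the length of the crossing sequences. -/
theorem exists_simulator_comp {x : List A} (D : M.Comp x) (hD : M.Accepting x D) :
    ∃ C : M.simulator.Comp x, M.simulator.Accepting x C ∧
      M.simulator.space x C ≤ max 1 (M.crossingLength x D) := by
  obtain ⟨a, m, h, hm, hL, hR, hu⟩ := exists_simReach D hD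
  obtain ⟨t, i, -, hc⟩ := h.simulatorReach le_rfl
  replace hc := hc.tail_move (.accept _ _ hu (by simp [SimCfg.control, hL])
    (by simp [SimCfg.control, hR])) (by simp) (HeadMove.stay_apply _)
    (HeadMove.stay_apply _) h.one_le
  obtain ⟨l, f, h0, hl, hf⟩ := exists_path_of_reflTransGen hc
  have ha : (f l).state ∈ M.simulator.accept := by rw [hl]; rfl
  refine ⟨⟨f, l, h0, fun i hi => (hf i (by exact_mod_cast hi)).1, ?_⟩, ⟨l, rfl, ha⟩, ?_⟩
  · intro n hn d hd
    rw [Nat.cast_inj] at hn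
    exact hd.1 (hn ▸ ha)
  · refine le_trans ?_ hm
    refine (Set.encard_le_encard (t := Finset.range m) ?_).trans
      (by rw [Set.encard_coe_eq_coe_finsetCard, Finset.card_range])
    rintro p ⟨j, hj, rfl⟩
    simp only [Nat.cast_le] at hj
    rw [Finset.coe_range, Set.mem_Iio]
    rcases j with _ | j
    · dsimp only
      rw [h0]
      exact h.one_le
    · exact (hf j hj).2

end OneTapeTM

/-! ### Transfer to the weak and accept measures -/

theorem worstCase_le_max {A : Type*} {f g : List A → ℕ∞} (h : ∀ x, f x ≤ max 1 (g x)) (n : ℕ) :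
    worstCase f n ≤ max 1 (worstCase g n) :=
  iSup_le fun x => (h x.1).trans
    (max_le_max le_rfl (le_iSup (fun x : {x : List A // x.length = n} => g x.1) x))

theorem theorem5 {A : Type*} [Finite A] (M : OneTapeTM A) :
    ∃ M' : StandardTM A, M'.OneWay ∧ M'.language = M.language ∧
      ∀ c : ℕ → ℕ∞,
        ((∀ n, M.weakCrossing n ≤ c n) → ∀ n, M'.weakSpace n ≤ max 1 (c n)) ∧
        ((∀ n, M.strongCrossing n ≤ c n) ∨ (∀ n, M.acceptCrossing n ≤ c n) →
          ∀ n, M'.acceptSpace n ≤ max 1 (c n)) := by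
  have hlang : M.simulator.language = M.language := by
    ext x
    refine ⟨fun ⟨C, hC⟩ => ?_, fun ⟨D, hD⟩ => ?_⟩
    · obtain ⟨D, hD, -⟩ := OneTapeTM.exists_comp_of_simulator C hC
      exact ⟨D, hD⟩
    · obtain ⟨C, hC, -⟩ := OneTapeTM.exists_simulator_comp D hD
      exact ⟨C, hC⟩
  have hmem (x : List A) : x ∈ acceptedLanguage M.simulator.Accepting ↔
      x ∈ acceptedLanguage M.Accepting := Set.ext_iff.1 hlang x
  have hweak (x : List A) : weakOn M.simulator.Accepting M.simulator.space x ≤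
      max 1 (weakOn M.Accepting M.crossingLength x) := by
    unfold weakOn
    by_cases hx : x ∈ acceptedLanguage M.Accepting
    · rw [if_pos ((hmem x).2 hx), if_pos hx]
      have : Nonempty {D : M.Comp x // M.Accepting x D} := let ⟨D, hD⟩ := hx; ⟨⟨D, hD⟩⟩
      -- The minimum is attained, so a single optimal computation of `M` has to be simulated.
      obtain ⟨⟨D, hD⟩, hmin⟩ :=
        ciInf_mem fun D : {D : M.Comp x // M.Accepting x D} =>
          M.crossingLength x D.1
      obtain ⟨C, hC, hle⟩ := OneTapeTM.exists_simulator_comp D hD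
      rw [← hmin]
      exact (iInf_le _ (⟨C, hC⟩ : {C : M.simulator.Comp x // M.simulator.Accepting x C})).trans hle
    · rw [if_neg (mt (hmem x).1 hx)]
      exact zero_le
  have haccept (x : List A) : acceptOn M.simulator.Accepting M.simulator.space x ≤
      max 1 (acceptOn M.Accepting M.crossingLength x) := by
    unfold acceptOn
    by_cases hx : x ∈ acceptedLanguage M.Accepting
    · rw [if_pos ((hmem x).2 hx), if_pos hx]
      refine iSup_le fun C => ?_
      -- Here every accepting computation of the simulating machine must be dominated by one of `M`.
      obtain ⟨D, hD, hle⟩ := OneTapeTM.exists_comp_of_simulator C.1 C.2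
      exact hle.trans (max_le_max le_rfl (le_iSup
        (fun D : {D : M.Comp x // M.Accepting x D} => M.crossingLength x D.1) ⟨D, hD⟩))
    · rw [if_neg (mt (hmem x).1 hx)]
      exact zero_le
  have hstrong (n : ℕ) : M.acceptCrossing n ≤ M.strongCrossing n := by
    refine iSup_mono fun x => ?_
    unfold acceptOn
    split_ifs
    · exact iSup_le fun D => le_iSup (M.crossingLength x.1) D.1
    · exact zero_le
  refine ⟨M.simulator, M.simulator_oneWay, hlang, fun c => ⟨fun h n => ?_, fun h n => ?_⟩⟩
  · exact (worstCase_le_max hweak n).trans (max_le_max le_rfl (h n))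
  · refine (worstCase_le_max haccept n).trans (max_le_max le_rfl ?_)
    exact h.elim (fun h => (hstrong n).trans (h n)) fun h => h n
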